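/- **Definitions.** Consider polynomials of the form $$W(x,y)=x^n+\sum_{i=d}^n A_i x^{n-i}y^i\in\mathbf C[x,y],\qquad A_d\neq 0,\ 1\le d\le n. \tag{1}$$ For $q>0$, $q\ne1$, put $W^{\sigma_q}(x,y)=W\left(\frac{x+(q-1)y}{\sqrt q},\frac{x-y}{\sqrt q}\right)$. A *Type III formal weight enumerator* of degree $n$ is a polynomial $W$ of the form (1) with $W\in\mathbf C[\,x^4+8xy^3,\ x^6-20x^3y^3-8y^6\,]$ and $W^{\sigma_3}=-W$; it is *extremal* if $d=3\left\lfloor\frac{n-6}{12}\right\rfloor+3$. The *zeta polynomial* (for $q$) of $W$ of the form (1) is the unique $P(T)\in\mathbf C[T]$ of degree at most $n-d$ such that the coefficient of $T^{n-d}$ in the power series expansion of $$\frac{P(T)}{(1-T)(1-qT)}\,\bigl(y(1-T)+xT\bigr)^n$$ equals $\frac{W(x,y)-x^n}{q-1}$. A polynomial $W$ of the form (1) with $W^{\sigma_q}=\pm W$ *satisfies the Riemann hypothesis* if all zeros of its zeta polynomial have absolute value $1/\sqrt q$. Finally $(a)_4=a(a+1)(a+2)(a+3)$. **Theorem 1.2**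 (analog of Okuda's theorem). Let $k\ge1$, let $W(x,y)$ be the Type III extremal formal weight enumerator of degree $n=12k+6$ (that is, any polynomial meeting the definition), and put $$W^\ast(x,y)=\frac1{(n-3)_4}\,\frac{\partial}{\partial x}\left(\frac{\partial^3}{\partial x^3}+\frac{\partial^3}{\partial y^3}\right)W(x,y).$$ Then $W^\ast$ is the (unique) Type III extremal formal weight enumerator of degree $n-4$. Moreover, the zeta polynomials $P(T)$ of $W$ and $P^\ast(T)$ of $W^\ast$, both for $q=3$, satisfy $$P^\ast(T)=(3T^2-3T+1)\,P(T),$$ and $W$ satisfies the Riemann hypothesis (for $q=3$) if and only if $W^\ast$ does. -/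

import Mathlib

open MvPolynomial

/-- `W(ax+by, cx+dy)` for the matrix with rows `(a, b)` and `(c, d)`; here `x = X 0`, `y = X 1`. -/
noncomputable def linearAction (M : Matrix (Fin 2) (Fin 2) ℂ) (W : MvPolynomial (Fin 2) ℂ) :
    MvPolynomial (Fin 2) ℂ :=
  aeval ![C (M 0 0) * X 0 + C (M 0 1) * X 1, C (M 1 0) * X 0 + C (M 1 1) * X 1] W

/-- The MacWilliams transform `σ_q = (1/√q) (1, q-1; 1, -1)`. -/
noncomputable def macWilliams (q : ℝ) : Matrix (Fin 2) (Fin 2) ℂ :=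
  (1 / (Real.sqrt q : ℂ)) • !![1, (q : ℂ) - 1; 1, -1]

/-- `W = x^n + ∑_{i=d}^n A_i x^{n-i} y^i` with `A_d ≠ 0` and `1 ≤ d ≤ n`. -/
def HasForm (n d : ℕ) (W : MvPolynomial (Fin 2) ℂ) : Prop :=
  1 ≤ d ∧ d ≤ n ∧ ∃ A : ℕ → ℂ, A d ≠ 0 ∧
    W = X 0 ^ n + ∑ i ∈ Finset.Icc d n, C (A i) * X 0 ^ (n - i) * X 1 ^ i

/-- `W_4 = x^4 + 8 x y^3`. -/
noncomputable def W4 : MvPolynomial (Fin 2) ℂ := X 0 ^ 4 + 8 * X 0 * X 1 ^ 3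

/-- `ψ_6 = x^6 - 20 x^3 y^3 - 8 y^6`. -/
noncomputable def psi6 : MvPolynomial (Fin 2) ℂ :=
  X 0 ^ 6 - 20 * X 0 ^ 3 * X 1 ^ 3 - 8 * X 1 ^ 6

/-- `W`, of the form `x^n + A_d x^{n-d} y^d + ⋯`, is a Type III formal weight enumerator: it lies
in the ring `ℂ[W_4, ψ_6]` and the MacWilliams transform for `q = 3` sends it to `-W`. -/
def IsTypeIIIFWE (n d : ℕ) (W : MvPolynomial (Fin 2) ℂ) : Prop :=
  HasForm n d W ∧ W ∈ Algebra.adjoin ℂ ({W4, psi6} : Set (MvPolynomial (Fin 2) ℂ)) ∧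
    linearAction (macWilliams 3) W = -W

/-- `W` is an extremal Type III formal weight enumerator of degree `n`:
`d = 3 ⌊(n-6)/12⌋ + 3`. -/
def IsExtremalTypeIII (n : ℕ) (W : MvPolynomial (Fin 2) ℂ) : Prop :=
  ∃ d : ℕ, IsTypeIIIFWE n d W ∧ (d : ℤ) = 3 * ⌊((n : ℝ) - 6) / 12⌋ + 3

/-- The power series `P(T) / ((1 - T) (1 - qT))`. -/
noncomputable def zetaSeries (q : ℝ) (P : Polynomial ℂ) : PowerSeries ℂ :=
  (P : PowerSeries ℂ) *
    ((1 - PowerSeries.X) * (1 - PowerSeries.C (q : ℂ) * PowerSeries.X))⁻¹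

/-- `P` has degree at most `n - d`, and in the expansion of
`P(T) / ((1 - T) (1 - qT)) * (y (1 - T) + x T)^n` in powers of `T` the coefficient of `T^{n-d}`
is `(W - x^n) / (q - 1)`. -/
def IsZetaPolynomialAt (q : ℝ) (n d : ℕ) (W : MvPolynomial (Fin 2) ℂ) (P : Polynomial ℂ) : Prop :=
  P.natDegree ≤ n - d ∧
    PowerSeries.coeff (n - d)
      (PowerSeries.map (C : ℂ →+* MvPolynomial (Fin 2) ℂ) (zetaSeries q P) *
        (PowerSeries.C (X 1 : MvPolynomial (Fin 2) ℂ) * (1 - PowerSeries.X) +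
          PowerSeries.C (X 0 : MvPolynomial (Fin 2) ℂ) * PowerSeries.X) ^ n) =
      C (1 / ((q : ℂ) - 1)) * (W - X 0 ^ n)

/-- `P` is the zeta polynomial of `W` for `q`. -/
def IsZetaPolynomial (q : ℝ) (W : MvPolynomial (Fin 2) ℂ) (P : Polynomial ℂ) : Prop :=
  ∃ n d : ℕ, HasForm n d W ∧ IsZetaPolynomialAt q n d W P

/-- The zeta polynomial of `W` for `q`; it exists and is unique for every `W` of the form
`x^n + A_d x^{n-d} y^d + ⋯`, see `existsUnique_isZetaPolynomial`. -/
noncomputable def zetaPolynomial (q : ℝ) (W : MvPolynomial (Fin 2) ℂ) : Polynomial ℂ :=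
  Classical.epsilon (IsZetaPolynomial q W)

/-- The Riemann hypothesis for `W`: all zeros of its zeta polynomial have absolute value
`1/√q`. -/
def RiemannHyp (q : ℝ) (W : MvPolynomial (Fin 2) ℂ) : Prop :=
  ∀ z : ℂ, (zetaPolynomial q W).IsRoot z → ‖z‖ = 1 / Real.sqrt q

/-- The exponent vector of the monomial `x^a y^b`. -/
noncomputable def expo (a b : ℕ) : Fin 2 →₀ ℕ := Finsupp.single 0 a + Finsupp.single 1 b

theorem expo_inj {a b c d : ℕ} : expo a b = expo c d ↔ a = c ∧ b = d := by
  constructor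
  · intro h
    have h0 := DFunLike.congr_fun h 0
    have h1 := DFunLike.congr_fun h 1
    simp [expo] at h0 h1
    exact ⟨h0, h1⟩
  · rintro ⟨rfl, rfl⟩; rfl

theorem coeff_expo (c : ℂ) (a b a' b' : ℕ) :
    coeff (expo a' b') (C c * X 0 ^ a * X 1 ^ b : MvPolynomial (Fin 2) ℂ) =
      if a = a' ∧ b = b' then c else 0 := by
  have : (C c * X 0 ^ a * X 1 ^ b : MvPolynomial (Fin 2) ℂ) = monomial (expo a b) c := by
    rw [expo, X_pow_eq_monomial, X_pow_eq_monomial, C_mul_monomial, monomial_mul]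
    simp
  rw [this, coeff_monomial]
  simp only [expo_inj]

theorem HasForm.coeff_y {n d : ℕ} {W : MvPolynomial (Fin 2) ℂ} (h : HasForm n d W) :
    ∃ A : ℕ → ℂ, A d ≠ 0 ∧
      W = X 0 ^ n + ∑ i ∈ Finset.Icc d n, C (A i) * X 0 ^ (n - i) * X 1 ^ i ∧
      ∀ a b, coeff (expo a b) W =
        (if n = a ∧ 0 = b then 1 else 0) + if (d ≤ b ∧ b ≤ n) ∧ n - b = a then A b else 0 := by
  obtain ⟨h1, h2, A, hA, hW⟩ := h
  refine ⟨A, hA, hW, fun a b => ?_⟩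
  rw [hW, coeff_add, coeff_sum]
  congr 1
  · have := coeff_expo 1 n 0 a b
    simpa using this
  · simp only [coeff_expo]
    by_cases hb : d ≤ b ∧ b ≤ n
    · rw [Finset.sum_eq_single b]
      · simp [hb]
      · intro i _ hi; simp [hi]
      · intro h; exact absurd (Finset.mem_Icc.2 hb) h
    · rw [Finset.sum_eq_zero, if_neg (fun h => hb h.1)]
      intro i hi
      rw [if_neg]
      rintro ⟨-, rfl⟩
      exact hb (Finset.mem_Icc.1 hi)

/-- The numbers `n` and `d` are determined by the polynomial. -/
theorem HasForm.unique {n d n' d' : ℕ} {W : MvPolynomial (Fin 2) ℂ} (h : HasForm n d W)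
    (h' : HasForm n' d' W) : n = n' ∧ d = d' := by
  obtain ⟨A, hA, -, hc⟩ := h.coeff_y
  obtain ⟨A', hA', -, hc'⟩ := h'.coeff_y
  obtain ⟨h1, h2, -⟩ := h
  obtain ⟨h1', h2', -⟩ := h'
  have hn : n = n' := by
    by_contra hne
    have e := (hc n 0).symm.trans (hc' n 0)
    have u : ¬ (d ≤ 0) := by omega
    have u' : ¬ (d' ≤ 0) := by omega
    have u2 : ¬ n' = n := fun h => hne h.symm
    simp [u, u', u2] at e
  subst hn
  refine ⟨rfl, le_antisymm ?_ ?_⟩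
  · by_contra hlt
    have e := (hc (n - d') d').symm.trans (hc' (n - d') d')
    have u : ¬ (0 = d') := by omega
    have u2 : ¬ d ≤ d' := by omega
    simp [u, u2, h2'] at e
    exact hA' e.symm
  · by_contra hlt
    have e := (hc (n - d) d).symm.trans (hc' (n - d) d)
    have u : ¬ (0 = d) := by omega
    have u2 : ¬ d' ≤ d := by omega
    simp [u, u2, h2] at e
    exact hA e

theorem coeff_zeta_expansion (Z : PowerSeries ℂ) (n m : ℕ) (hm : m ≤ n) :
    PowerSeries.coeff m
      (PowerSeries.map (C : ℂ →+* MvPolynomial (Fin 2) ℂ) Z *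
        (PowerSeries.C (X 1 : MvPolynomial (Fin 2) ℂ) * (1 - PowerSeries.X) +
          PowerSeries.C (X 0 : MvPolynomial (Fin 2) ℂ) * PowerSeries.X) ^ n) =
      ∑ j ∈ Finset.range (m + 1),
        C ((n.choose (m - j) : ℂ) *
          PowerSeries.coeff j (Z * (1 - PowerSeries.X) ^ (n - (m - j)))) *
          X 0 ^ (m - j) * X 1 ^ (n - (m - j)) := by
  rw [add_comm, add_pow, Finset.mul_sum, map_sum]
  have key : ∀ l, PowerSeries.coeff m
      (PowerSeries.map (C : ℂ →+* MvPolynomial (Fin 2) ℂ) Z *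
        ((PowerSeries.C (X 0 : MvPolynomial (Fin 2) ℂ) * PowerSeries.X) ^ l *
          (PowerSeries.C (X 1 : MvPolynomial (Fin 2) ℂ) * (1 - PowerSeries.X)) ^ (n - l) *
          (n.choose l : PowerSeries (MvPolynomial (Fin 2) ℂ)))) =
      if l ≤ m then C ((n.choose l : ℂ) *
          PowerSeries.coeff (m - l) (Z * (1 - PowerSeries.X) ^ (n - l))) *
          X 0 ^ l * X 1 ^ (n - l) else 0 := by
    intro l
    have e : (PowerSeries.map (C : ℂ →+* MvPolynomial (Fin 2) ℂ) Z *
        ((PowerSeries.C (X 0 : MvPolynomial (Fin 2) ℂ) * PowerSeries.X) ^ l *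
          (PowerSeries.C (X 1 : MvPolynomial (Fin 2) ℂ) * (1 - PowerSeries.X)) ^ (n - l) *
          (n.choose l : PowerSeries (MvPolynomial (Fin 2) ℂ)))) =
        PowerSeries.C ((n.choose l : MvPolynomial (Fin 2) ℂ) * X 0 ^ l * X 1 ^ (n - l)) *
          (PowerSeries.X ^ l *
          PowerSeries.map (C : ℂ →+* MvPolynomial (Fin 2) ℂ) (Z * (1 - PowerSeries.X) ^ (n - l))) := by
      simp only [map_mul, map_pow, map_sub, map_one, PowerSeries.map_X, map_natCast, mul_pow]
      ring
    rw [e, PowerSeries.coeff_C_mul, PowerSeries.coeff_X_pow_mul']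
    split_ifs with h
    · rw [PowerSeries.coeff_map, C_mul, map_natCast]
      ring
    · simp
  simp only [key]
  have hsub : Finset.range (m + 1) ⊆ Finset.range (n + 1) := by
    intro i hi; simp at hi ⊢; omega
  rw [← Finset.sum_subset hsub]
  · rw [← Finset.sum_range_reflect]
    refine Finset.sum_congr rfl fun j hj => ?_
    have hj' : j ≤ m := by simp at hj; omega
    have e1 : m + 1 - 1 - j = m - j := by omega
    have e2 : m - (m - j) = j := by omega
    rw [e1, if_pos (Nat.sub_le _ _), e2]
  · intro i _ hi
    rw [if_neg]
    simp at hi; omega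

theorem coeff_eq_zero_of_mul (Z : PowerSeries ℂ) (m : ℕ) (f : ℕ → PowerSeries ℂ)
    (hf : ∀ j, PowerSeries.constantCoeff (f j) = 1)
    (h : ∀ j ≤ m, PowerSeries.coeff j (Z * f j) = 0) : ∀ j ≤ m, PowerSeries.coeff j Z = 0 := by
  intro j
  induction j using Nat.strong_induction_on with
  | _ j ih =>
    intro hj
    have e := h j hj
    rw [PowerSeries.coeff_mul, Finset.sum_eq_single (j, 0)] at e
    · simpa [hf] using e
    · rintro ⟨a, b⟩ hab hne
      rw [Finset.HasAntidiagonal.mem_antidiagonal] at hab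
      have hb : b ≠ 0 := by
        rintro rfl
        apply hne
        simp at hab
        simp [hab]
      simp only at hab ⊢
      rw [ih a (by omega) (by omega), zero_mul]
    · intro hn; simp at hn

theorem zetaSeries_mul (q : ℝ) (P : Polynomial ℂ) :
    zetaSeries q P * ((1 - PowerSeries.X) * (1 - PowerSeries.C (q : ℂ) * PowerSeries.X)) =
      (P : PowerSeries ℂ) := by
  rw [zetaSeries, mul_assoc, PowerSeries.inv_mul_cancel _ (by simp), mul_one]

/-- The vector of coefficients that determines the zeta polynomial. -/
noncomputable def zetaMap (q : ℝ) (n m : ℕ) :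
    Polynomial.degreeLT ℂ (m + 1) →ₗ[ℂ] (Fin (m + 1) → ℂ) where
  toFun P j := PowerSeries.coeff j.1
    (zetaSeries q P.1 * (1 - PowerSeries.X) ^ (n - (m - j.1)))
  map_add' P Q := by
    ext j
    simp [zetaSeries, add_mul]
  map_smul' c P := by
    ext j
    simp [zetaSeries, Polynomial.coe_smul]

theorem zetaMap_bijective (q : ℝ) (n m : ℕ) : Function.Bijective (zetaMap q n m) := by
  have inj : Function.Injective (zetaMap q n m) := by
    rw [← LinearMap.ker_eq_bot, LinearMap.ker_eq_bot']
    intro P hP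
    have hz := coeff_eq_zero_of_mul (zetaSeries q P.1) m
      (fun j => (1 - PowerSeries.X) ^ (n - (m - j))) (by simp) (fun j hj =>
        congrFun hP ⟨j, by omega⟩)
    apply Subtype.ext
    ext i
    by_cases hi : i ≤ m
    · rw [← Polynomial.coeff_coe, ← zetaSeries_mul q, PowerSeries.coeff_mul]
      refine Finset.sum_eq_zero fun ab hab => ?_
      rw [Finset.HasAntidiagonal.mem_antidiagonal] at hab
      rw [hz ab.1 (by omega), zero_mul]
    · have := Polynomial.mem_degreeLT.1 P.2
      rw [Polynomial.coeff_eq_zero_of_degree_lt]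
      · rfl
      · refine lt_of_lt_of_le this ?_
        exact_mod_cast (by omega : m + 1 ≤ i)
  refine ⟨inj, (LinearMap.injective_iff_surjective_of_finrank_eq_finrank ?_).1 inj⟩
  rw [(Polynomial.degreeLTEquiv ℂ (m + 1)).finrank_eq]

/-- Existence and uniqueness of the zeta polynomial. -/
theorem existsUnique_isZetaPolynomialAt (q : ℝ) {n d : ℕ} {W : MvPolynomial (Fin 2) ℂ}
    (h : HasForm n d W) : ∃! P, IsZetaPolynomialAt q n d W P := by
  obtain ⟨A, -, hW, -⟩ := h.coeff_y
  obtain ⟨h1, h2, -⟩ := h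
  set m := n - d with hm
  have hch : ∀ j ≤ m, (n.choose (m - j) : ℂ) ≠ 0 := fun j hj => by
    exact_mod_cast (Nat.choose_pos (by omega)).ne'
  have hR : C (1 / ((q : ℂ) - 1)) * (W - X 0 ^ n) = ∑ j ∈ Finset.range (m + 1),
      (C (1 / ((q : ℂ) - 1) * A (n - (m - j))) * X 0 ^ (m - j) * X 1 ^ (n - (m - j)) :
        MvPolynomial (Fin 2) ℂ) := by
    rw [hW, add_sub_cancel_left, Finset.mul_sum]
    symm
    refine Finset.sum_bij (fun j _ => d + j) ?_ ?_ ?_ ?_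
    · intro j hj; simp at hj ⊢; omega
    · intro a _ b _ hab; omega
    · intro b hb
      simp at hb
      exact ⟨b - d, by simp; omega, by omega⟩
    · intro j hj
      simp at hj
      have e1 : n - (m - j) = d + j := by omega
      have e2 : n - (d + j) = m - j := by omega
      rw [e1, e2, map_mul]
      ring
  have iff : ∀ P, IsZetaPolynomialAt q n d W P ↔ ∃ hP : P ∈ Polynomial.degreeLT ℂ (m + 1),
      zetaMap q n m ⟨P, hP⟩ = fun j => 1 / ((q : ℂ) - 1) * A (n - (m - j.1)) /
        (n.choose (m - j.1) : ℂ) := by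
    intro P
    have hdeg : P.natDegree ≤ m ↔ P ∈ Polynomial.degreeLT ℂ (m + 1) := by
      rw [Polynomial.mem_degreeLT, Polynomial.natDegree_le_iff_coeff_eq_zero,
        Polynomial.degree_lt_iff_coeff_zero]
      rfl
    rw [IsZetaPolynomialAt, ← hm, coeff_zeta_expansion _ n m (by omega), hR, hdeg,
      ← exists_prop]
    refine exists_congr fun hP => ⟨fun e => ?_, fun e => ?_⟩
    · ext j
      have hj : j.1 ≤ m := by omega
      have e' := congrArg (coeff (expo (m - j.1) (n - (m - j.1)))) e
      simp only [coeff_sum, coeff_expo] at e'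
      rw [Finset.sum_eq_single j.1, Finset.sum_eq_single j.1] at e'
      · simp only [and_self, if_true] at e'
        rw [eq_div_iff (hch _ hj), ← e', mul_comm]
        rfl
      all_goals first
        | (intro i hi hij; simp at hi; rw [if_neg]; omega)
        | (intro hh; simp at hh; omega)
    · refine Finset.sum_congr rfl fun j hj => ?_
      have hj' : j < m + 1 := by simpa using hj
      have e' := congrFun e ⟨j, hj'⟩
      simp only at e'
      rw [eq_div_iff (hch _ (by omega)), mul_comm] at e'
      rw [← e']
      rfl
  obtain ⟨P, hP⟩ := (zetaMap_bijective q n m).2 (fun j => 1 / ((q : ℂ) - 1) *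
    A (n - (m - j.1)) / (n.choose (m - j.1) : ℂ))
  refine ⟨P.1, (iff _).2 ⟨P.2, hP⟩, fun Q hQ => ?_⟩
  obtain ⟨hQ1, hQ2⟩ := (iff _).1 hQ
  exact congrArg Subtype.val ((zetaMap_bijective q n m).1 (hQ2.trans hP.symm))

theorem existsUnique_isZetaPolynomial (q : ℝ) {n d : ℕ} {W : MvPolynomial (Fin 2) ℂ}
    (h : HasForm n d W) : ∃! P, IsZetaPolynomial q W P := by
  obtain ⟨P, hP, hu⟩ := existsUnique_isZetaPolynomialAt q h
  refine ⟨P, ⟨n, d, h, hP⟩, ?_⟩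
  rintro Q ⟨n', d', h', hQ⟩
  obtain ⟨rfl, rfl⟩ := h.unique h'
  exact hu Q hQ

theorem zetaPolynomial_eq_iff (q : ℝ) {n d : ℕ} {W : MvPolynomial (Fin 2) ℂ}
    (h : HasForm n d W) (P : Polynomial ℂ) :
    zetaPolynomial q W = P ↔ IsZetaPolynomialAt q n d W P := by
  have hs : IsZetaPolynomial q W (zetaPolynomial q W) :=
    Classical.epsilon_spec (existsUnique_isZetaPolynomial q h).exists
  constructor
  · rintro rfl
    obtain ⟨n', d', h', hQ⟩ := hs
    obtain ⟨rfl, rfl⟩ := h.unique h'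
    exact hQ
  · intro hP
    exact (existsUnique_isZetaPolynomial q h).unique hs ⟨n, d, h, hP⟩

/-! Write `D = ∂_x (∂_x^3 + ∂_y^3)` and `L = y(1-T) + xT`. As `∂_x L = T` and `∂_y L = 1-T`, `D`
sends `Z(T) L^n` to `(n-3)_4 T (T^3 + (1-T)^3) Z(T) L^{n-4}`, and `T^3 + (1-T)^3 = 3T^2 - 3T + 1`.
The extra `T` moves the coefficient index from `n-d` to `n-d-1 = (n-4)-(d-3)`, so `(3T^2-3T+1) P`
has the defining property of the zeta polynomial of `W*`, once its degree is known to be small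
enough (`IsZetaPolynomialAt.quarticOp`). That bound comes from MacWilliams duality, which gives `deg
P ≤ n+2-2d` (`natDegree_zetaPolynomial_le`). Both zeros of the quadratic have modulus `1/√3`, so the
two Riemann hypotheses are equivalent.

`W*` is a formal weight enumerator because `D`, rewritten by the chain rule in the variables `W_4`,
`ψ_6`, has polynomial coefficients (`quarticOp_aeval`), and because degree `12k+2` allows only odd
powers of `ψ_6`, which fixes the sign (`linearAction_eq_neg`). The gap `d` drops by exactly `3`, to
the extremal value `3k`.

Uniqueness is a vanishing statement (`eq_zero_of_coeff_eq_zero`): with `x = 1`, an element of degree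
`12k+2` is a unit times `g(ψ_6^2/W_4^3)` with `deg g < k`, and `ψ_6^2/W_4^3 - 1` has order exactly
`3` in `y`. Hence order at least `3k` forces `g = 0`. -/

/-! ### Monomials and the form (1) in terms of coefficients -/

theorem expo_add_single_zero (a b : ℕ) : expo a b + Finsupp.single 0 1 = expo (a + 1) b := by
  simp only [expo, Finsupp.single_add]; abel

theorem expo_add_single_one (a b : ℕ) : expo a b + Finsupp.single 1 1 = expo a (b + 1) := by
  simp only [expo, Finsupp.single_add]; abel

theorem eq_expo (m : Fin 2 →₀ ℕ) : m = expo (m 0) (m 1) := by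
  ext i; fin_cases i <;> simp [expo]

theorem degree_expo (a b : ℕ) : (expo a b).degree = a + b := by
  simp [expo]

theorem isHomogeneous_C_mul_X_pow_mul_X_pow (c : ℂ) {a b n : ℕ} (h : a + b = n) :
    (C c * X 0 ^ a * X 1 ^ b : MvPolynomial (Fin 2) ℂ).IsHomogeneous n := by
  subst h
  exact (isHomogeneous_C_mul_X_pow _ _ _).mul (isHomogeneous_X_pow _ _)

/-- Homogeneity and conditions on single coefficients are easy to follow through differentiation and
subtraction, unlike an explicit sum. -/
theorem hasForm_iff {n d : ℕ} {W : MvPolynomial (Fin 2) ℂ} :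
    HasForm n d W ↔ 1 ≤ d ∧ d ≤ n ∧ W.IsHomogeneous n ∧ coeff (expo n 0) W = 1 ∧
      (∀ b, 0 < b → b < d → coeff (expo (n - b) b) W = 0) ∧ coeff (expo (n - d) d) W ≠ 0 := by
  constructor
  · intro h
    obtain ⟨A, hA, hW, hc⟩ := h.coeff_y
    obtain ⟨h1, h2, -⟩ := h
    refine ⟨h1, h2, ?_, ?_, ?_, ?_⟩
    · rw [hW]
      refine (isHomogeneous_X_pow _ _).add (IsHomogeneous.sum _ _ _ fun i hi => ?_)
      have := Finset.mem_Icc.1 hi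
      exact isHomogeneous_C_mul_X_pow_mul_X_pow _ (by omega)
    · rw [hc, if_pos ⟨rfl, rfl⟩, if_neg (by omega), add_zero]
    · intro b hb hbd
      rw [hc, if_neg (by omega), if_neg (by omega), add_zero]
    · rw [hc, if_neg (by omega), if_pos (by omega), zero_add]
      exact hA
  · rintro ⟨h1, h2, hh, hn, hz, hd⟩
    refine ⟨h1, h2, fun i => coeff (expo (n - i) i) W, hd, ?_⟩
    ext m
    rw [eq_expo m]
    generalize m 0 = a
    generalize m 1 = b
    have key : coeff (expo a b) (X 0 ^ n + ∑ i ∈ Finset.Icc d n,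
        C (coeff (expo (n - i) i) W) * X 0 ^ (n - i) * X 1 ^ i) =
        (if n = a ∧ 0 = b then 1 else 0) +
          ∑ i ∈ Finset.Icc d n, if n - i = a ∧ i = b then coeff (expo (n - i) i) W else 0 := by
      rw [coeff_add, coeff_sum]
      congr 1
      · simpa using coeff_expo 1 n 0 a b
      · simp only [coeff_expo]
    rw [key]
    by_cases hab : a + b = n
    · obtain rfl : a = n - b := by omega
      rcases Nat.eq_zero_or_pos b with rfl | hb
      · rw [if_pos (by omega), Finset.sum_eq_zero, add_zero]
        · simpa using hn
        · intro i hi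
          have := Finset.mem_Icc.1 hi
          rw [if_neg (by omega)]
      · rw [if_neg (by omega), zero_add]
        by_cases hbd : b < d
        · rw [hz b hb hbd, Finset.sum_eq_zero]
          intro i hi
          have := Finset.mem_Icc.1 hi
          rw [if_neg (by omega)]
        · rw [Finset.sum_eq_single b]
          · simp
          · intro i _ hi; rw [if_neg (by omega)]
          · intro h; exact absurd (Finset.mem_Icc.2 (by omega)) h
    · rw [hh.coeff_eq_zero (by rwa [degree_expo]), if_neg (by omega), Finset.sum_eq_zero, add_zero]
      intro i hi
      have := Finset.mem_Icc.1 hi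
      rw [if_neg (by omega)]

/-! ### The operator on coefficients -/

/-- The differential operator `∂_x (∂_x^3 + ∂_y^3)`. -/
noncomputable def quarticOp (W : MvPolynomial (Fin 2) ℂ) : MvPolynomial (Fin 2) ℂ :=
  pderiv 0 ((pderiv 0)^[3] W + (pderiv 1)^[3] W)

theorem quarticOp_eq (W : MvPolynomial (Fin 2) ℂ) :
    quarticOp W = pderiv 0 (pderiv 0 (pderiv 0 (pderiv 0 W)) +
      pderiv 1 (pderiv 1 (pderiv 1 W))) := rfl

theorem coeff_quarticOp (W : MvPolynomial (Fin 2) ℂ) (a b : ℕ) :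
    coeff (expo a b) (quarticOp W) =
      (a + 1) * (a + 2) * (a + 3) * (a + 4) * coeff (expo (a + 4) b) W +
        (a + 1) * (b + 1) * (b + 2) * (b + 3) * coeff (expo (a + 1) (b + 3)) W := by
  have e0 : ∀ a b, expo a b 0 = a := fun a b => by simp [expo]
  have e1 : ∀ a b, expo a b 1 = b := fun a b => by simp [expo]
  simp only [quarticOp_eq, map_add, coeff_add, coeff_pderiv, expo_add_single_zero,
    expo_add_single_one, e0, e1]
  push_cast
  ring

theorem isHomogeneous_quarticOp {W : MvPolynomial (Fin 2) ℂ} {n : ℕ} (h : W.IsHomogeneous n) :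
    (quarticOp W).IsHomogeneous (n - 4) := by
  have h0 := ((h.pderiv (i := 0)).pderiv (i := 0)).pderiv (i := 0)
  have h1 := ((h.pderiv (i := 1)).pderiv (i := 1)).pderiv (i := 1)
  exact (h0.add h1).pderiv

theorem eval_ascPochhammer_four (N : ℕ) :
    (ascPochhammer ℂ 4).eval (((N + 4 : ℕ) : ℂ) - 3) =
      ((N + 1) * (N + 2) * (N + 3) * (N + 4) : ℂ) := by
  simp only [ascPochhammer_succ_right, ascPochhammer_zero, one_mul, Polynomial.eval_mul,
    Polynomial.eval_add, Polynomial.eval_X, Polynomial.eval_natCast]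
  push_cast
  ring

/-- The coefficient of `y^b` in the image involves only those of `y^b` and `y^{b+3}` in `W`. Below
`d-3` both vanish, except for `x^n` at `b = 0`; at `d-3` only `A_d` survives. The bound `4 ≤ d`
keeps `A_3` out of the leading coefficient. -/
theorem HasForm.quarticOp {n d : ℕ} {W : MvPolynomial (Fin 2) ℂ} (h : HasForm n d W)
    (hd : 4 ≤ d) (hdn : d < n) :
    HasForm (n - 4) (d - 3)
      (C (1 / (ascPochhammer ℂ 4).eval ((n : ℂ) - 3)) * quarticOp W) := by
  obtain ⟨h1, h2, hh, hn, hz, hne⟩ := hasForm_iff.1 h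
  obtain ⟨N, rfl⟩ : ∃ N, n = N + 4 := ⟨n - 4, by omega⟩
  obtain ⟨e, rfl⟩ : ∃ e, d = e + 3 := ⟨d - 3, by omega⟩
  have hp0 : ((N + 1) * (N + 2) * (N + 3) * (N + 4) : ℂ) ≠ 0 := by
    norm_cast
  rw [eval_ascPochhammer_four]
  simp only [Nat.add_sub_cancel]
  refine hasForm_iff.2 ⟨by omega, by omega, (isHomogeneous_quarticOp hh).C_mul _, ?_, ?_, ?_⟩
  · have := hz 3 (by omega) (by omega)
    rw [show N + 4 - 3 = N + 1 by omega] at this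
    rw [coeff_C_mul, coeff_quarticOp, hn, zero_add, this, mul_zero, add_zero, mul_one]
    exact one_div_mul_cancel hp0
  · intro b hb hbe
    have t1 := hz b hb (by omega)
    have t2 := hz (b + 3) (by omega) (by omega)
    rw [show N + 4 - b = N - b + 4 by omega] at t1
    rw [show N + 4 - (b + 3) = N - b + 1 by omega] at t2
    rw [coeff_C_mul, coeff_quarticOp, t1, t2]
    simp
  · have t1 := hz e (by omega) (by omega)
    rw [show N + 4 - e = N - e + 4 by omega] at t1
    rw [show N + 4 - (e + 3) = N - e + 1 by omega] at hne
    rw [coeff_C_mul, coeff_quarticOp, t1, mul_zero, zero_add]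
    refine mul_ne_zero (one_div_ne_zero hp0) (mul_ne_zero ?_ hne)
    norm_cast

/-! ### Stability of the ring generated by `W_4` and `ψ_6` -/

theorem pderiv_comm (i j : Fin 2) (f : MvPolynomial (Fin 2) ℂ) :
    pderiv i (pderiv j f) = pderiv j (pderiv i f) := by
  -- The commutator of two derivations is a derivation, so it suffices to test it on the variables.
  have : ⁅(pderiv i : Derivation ℂ (MvPolynomial (Fin 2) ℂ) (MvPolynomial (Fin 2) ℂ)),
      (pderiv j : Derivation ℂ (MvPolynomial (Fin 2) ℂ) (MvPolynomial (Fin 2) ℂ))⁆ = 0 := by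
    refine derivation_ext fun k => ?_
    simp [Derivation.commutator_apply, pderiv_X, Pi.single_apply, apply_ite]
  have h := congrArg (fun D => D f) this
  simpa [Derivation.commutator_apply, sub_eq_zero] using h

theorem pderiv_aeval_pair (u v f : MvPolynomial (Fin 2) ℂ) (i : Fin 2) :
    pderiv i (aeval ![u, v] f) =
      aeval ![u, v] (pderiv 0 f) * pderiv i u + aeval ![u, v] (pderiv 1 f) * pderiv i v := by
  induction f using MvPolynomial.induction_on with
  | C a => simp
  | add p q hp hq => simp only [map_add, hp, hq]; ring
  | mul_X p j hp =>
    have h00 : pderiv 0 (X 0 : MvPolynomial (Fin 2) ℂ) = 1 := pderiv_X_self 0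
    have h11 : pderiv 1 (X 1 : MvPolynomial (Fin 2) ℂ) = 1 := pderiv_X_self 1
    have h01 : pderiv 0 (X 1 : MvPolynomial (Fin 2) ℂ) = 0 := pderiv_X_of_ne (by decide)
    have h10 : pderiv 1 (X 0 : MvPolynomial (Fin 2) ℂ) = 0 := pderiv_X_of_ne (by decide)
    rw [map_mul, Derivation.leibniz, hp]
    fin_cases j
    · simp only [Derivation.leibniz, aeval_X, h00, h10, Fin.zero_eta, smul_eq_mul, map_add,
        map_mul, Matrix.cons_val_zero, map_one, map_zero]
      ring
    · simp only [Derivation.leibniz, aeval_X, h01, h11, Fin.mk_one, smul_eq_mul, map_add,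
        map_mul, Matrix.cons_val_one, Matrix.cons_val_zero, map_one, map_zero]
      ring

/-- The third-order chain rule, kept for general `u`, `v` so that `W_4` and `ψ_6` need not be
expanded at this stage. -/
theorem pderiv_iterate_three_aeval_pair (u v f : MvPolynomial (Fin 2) ℂ) (i : Fin 2) :
    pderiv i (pderiv i (pderiv i (aeval ![u, v] f))) =
      aeval ![u, v] (pderiv 0 (pderiv 0 (pderiv 0 f))) * pderiv i u ^ 3 +
      3 * aeval ![u, v] (pderiv 0 (pderiv 0 (pderiv 1 f))) * pderiv i u ^ 2 * pderiv i v +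
      3 * aeval ![u, v] (pderiv 0 (pderiv 1 (pderiv 1 f))) * pderiv i u * pderiv i v ^ 2 +
      aeval ![u, v] (pderiv 1 (pderiv 1 (pderiv 1 f))) * pderiv i v ^ 3 +
      3 * aeval ![u, v] (pderiv 0 (pderiv 0 f)) * pderiv i u * pderiv i (pderiv i u) +
      3 * aeval ![u, v] (pderiv 0 (pderiv 1 f)) *
        (pderiv i u * pderiv i (pderiv i v) + pderiv i v * pderiv i (pderiv i u)) +
      3 * aeval ![u, v] (pderiv 1 (pderiv 1 f)) * pderiv i v * pderiv i (pderiv i v) +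
      aeval ![u, v] (pderiv 0 f) * pderiv i (pderiv i (pderiv i u)) +
      aeval ![u, v] (pderiv 1 f) * pderiv i (pderiv i (pderiv i v)) := by
  simp only [pderiv_aeval_pair u v, pderiv_comm 1 0, map_add, Derivation.leibniz, smul_eq_mul]
  ring

set_option linter.unusedSimpArgs false in
-- By the chain rule the coefficient of `∂_0^a ∂_1^b f` is a form of degree `4a + 6b - 4` in `x, y`;
-- the computation shows that it is a polynomial in `W_4` and `ψ_6`. The term `∂_1 f` is absent, as
-- no such polynomial has degree `2`.
theorem quarticOp_aeval (f : MvPolynomial (Fin 2) ℂ) :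
    quarticOp (aeval ![W4, psi6] f) = aeval ![W4, psi6]
      (72 * pderiv 0 f + 1008 * X 0 * pderiv 0 (pderiv 0 f) +
        4464 * X 1 * pderiv 0 (pderiv 1 f) + 4860 * X 0 ^ 2 * pderiv 1 (pderiv 1 f) +
        1152 * X 0 ^ 2 * pderiv 0 (pderiv 0 (pderiv 0 f)) +
        6336 * X 0 * X 1 * pderiv 0 (pderiv 0 (pderiv 1 f)) +
        (4320 * X 0 ^ 3 + 6912 * X 1 ^ 2) * pderiv 0 (pderiv 1 (pderiv 1 f)) +
        6480 * X 0 ^ 2 * X 1 * pderiv 1 (pderiv 1 (pderiv 1 f)) +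
        (192 * X 0 ^ 3 + 64 * X 1 ^ 2) * pderiv 0 (pderiv 0 (pderiv 0 (pderiv 0 f))) +
        1536 * X 0 ^ 2 * X 1 * pderiv 0 (pderiv 0 (pderiv 0 (pderiv 1 f))) +
        (864 * X 0 ^ 4 + 2592 * X 0 * X 1 ^ 2) * pderiv 0 (pderiv 0 (pderiv 1 (pderiv 1 f))) +
        (1728 * X 0 ^ 3 * X 1 + 1728 * X 1 ^ 3) *
          pderiv 0 (pderiv 1 (pderiv 1 (pderiv 1 f))) +
        (1620 * X 0 ^ 2 * X 1 ^ 2 - 324 * X 0 ^ 5) *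
          pderiv 1 (pderiv 1 (pderiv 1 (pderiv 1 f)))) := by
  have n0 : ∀ (i : Fin 2) (m : ℕ) [m.AtLeastTwo],
      pderiv i (OfNat.ofNat m : MvPolynomial (Fin 2) ℂ) = 0 := fun i m _ => by
    exact_mod_cast (pderiv i).map_natCast (OfNat.ofNat m)
  have x00 : pderiv 0 (X 0 : MvPolynomial (Fin 2) ℂ) = 1 := pderiv_X_self 0
  have x11 : pderiv 1 (X 1 : MvPolynomial (Fin 2) ℂ) = 1 := pderiv_X_self 1
  have x01 : pderiv 0 (X 1 : MvPolynomial (Fin 2) ℂ) = 0 := pderiv_X_of_ne (by decide)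
  have x10 : pderiv 1 (X 0 : MvPolynomial (Fin 2) ℂ) = 0 := pderiv_X_of_ne (by decide)
  have ux : pderiv 0 (W4 : MvPolynomial (Fin 2) ℂ) =
      4 * X 0 ^ 3 + 8 * X 1 ^ 3 := by
    simp only [W4, map_add, map_sub, map_neg, Derivation.leibniz, Derivation.leibniz_pow, n0, x00,
      x01, x10, x11, smul_eq_mul, nsmul_eq_mul, Nat.cast_ofNat, Nat.add_one_sub_one]
    ring
  have uy : pderiv 1 (W4 : MvPolynomial (Fin 2) ℂ) =
      24 * X 0 * X 1 ^ 2 := by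
    simp only [W4, map_add, map_sub, map_neg, Derivation.leibniz, Derivation.leibniz_pow, n0, x00,
      x01, x10, x11, smul_eq_mul, nsmul_eq_mul, Nat.cast_ofNat, Nat.add_one_sub_one]
    ring
  have vx : pderiv 0 (psi6 : MvPolynomial (Fin 2) ℂ) =
      6 * X 0 ^ 5 - 60 * X 0 ^ 2 * X 1 ^ 3 := by
    simp only [psi6, map_add, map_sub, map_neg, Derivation.leibniz, Derivation.leibniz_pow, n0, x00,
      x01, x10, x11, smul_eq_mul, nsmul_eq_mul, Nat.cast_ofNat, Nat.add_one_sub_one]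
    ring
  have vy : pderiv 1 (psi6 : MvPolynomial (Fin 2) ℂ) =
      -60 * X 0 ^ 3 * X 1 ^ 2 - 48 * X 1 ^ 5 := by
    simp only [psi6, map_add, map_sub, map_neg, Derivation.leibniz, Derivation.leibniz_pow, n0, x00,
      x01, x10, x11, smul_eq_mul, nsmul_eq_mul, Nat.cast_ofNat, Nat.add_one_sub_one]
    ring
  have uxx : pderiv 0 (4 * X 0 ^ 3 + 8 * X 1 ^ 3 : MvPolynomial (Fin 2) ℂ) =
      12 * X 0 ^ 2 := by
    simp only [map_add, map_sub, map_neg, Derivation.leibniz, Derivation.leibniz_pow, n0, x00,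
      x01, x10, x11, smul_eq_mul, nsmul_eq_mul, Nat.cast_ofNat, Nat.add_one_sub_one]
    ring
  have uyy : pderiv 1 (24 * X 0 * X 1 ^ 2 : MvPolynomial (Fin 2) ℂ) =
      48 * X 0 * X 1 := by
    simp only [map_add, map_sub, map_neg, Derivation.leibniz, Derivation.leibniz_pow, n0, x00,
      x01, x10, x11, smul_eq_mul, nsmul_eq_mul, Nat.cast_ofNat, Nat.add_one_sub_one]
    ring
  have vxx : pderiv 0 (6 * X 0 ^ 5 - 60 * X 0 ^ 2 * X 1 ^ 3 : MvPolynomial (Fin 2) ℂ) =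
      30 * X 0 ^ 4 - 120 * X 0 * X 1 ^ 3 := by
    simp only [map_add, map_sub, map_neg, Derivation.leibniz, Derivation.leibniz_pow, n0, x00,
      x01, x10, x11, smul_eq_mul, nsmul_eq_mul, Nat.cast_ofNat, Nat.add_one_sub_one]
    ring
  have vyy : pderiv 1 (-60 * X 0 ^ 3 * X 1 ^ 2 - 48 * X 1 ^ 5 : MvPolynomial (Fin 2) ℂ) =
      -120 * X 0 ^ 3 * X 1 - 240 * X 1 ^ 4 := by
    simp only [map_add, map_sub, map_neg, Derivation.leibniz, Derivation.leibniz_pow, n0, x00,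
      x01, x10, x11, smul_eq_mul, nsmul_eq_mul, Nat.cast_ofNat, Nat.add_one_sub_one]
    ring
  have uxxx : pderiv 0 (12 * X 0 ^ 2 : MvPolynomial (Fin 2) ℂ) =
      24 * X 0 := by
    simp only [map_add, map_sub, map_neg, Derivation.leibniz, Derivation.leibniz_pow, n0, x00,
      x01, x10, x11, smul_eq_mul, nsmul_eq_mul, Nat.cast_ofNat, Nat.add_one_sub_one]
    ring
  have uyyy : pderiv 1 (48 * X 0 * X 1 : MvPolynomial (Fin 2) ℂ) =
      48 * X 0 := by
    simp only [map_add, map_sub, map_neg, Derivation.leibniz, Derivation.leibniz_pow, n0, x00,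
      x01, x10, x11, smul_eq_mul, nsmul_eq_mul, Nat.cast_ofNat, Nat.add_one_sub_one]
    ring
  have vxxx : pderiv 0 (30 * X 0 ^ 4 - 120 * X 0 * X 1 ^ 3 : MvPolynomial (Fin 2) ℂ) =
      120 * X 0 ^ 3 - 120 * X 1 ^ 3 := by
    simp only [map_add, map_sub, map_neg, Derivation.leibniz, Derivation.leibniz_pow, n0, x00,
      x01, x10, x11, smul_eq_mul, nsmul_eq_mul, Nat.cast_ofNat, Nat.add_one_sub_one]
    ring
  have vyyy : pderiv 1 (-120 * X 0 ^ 3 * X 1 - 240 * X 1 ^ 4 : MvPolynomial (Fin 2) ℂ) =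
      -120 * X 0 ^ 3 - 960 * X 1 ^ 3 := by
    simp only [map_add, map_sub, map_neg, Derivation.leibniz, Derivation.leibniz_pow, n0, x00,
      x01, x10, x11, smul_eq_mul, nsmul_eq_mul, Nat.cast_ofNat, Nat.add_one_sub_one]
    ring
  have cm := pderiv_comm 1 0
  have ch : ∀ (i : Fin 2) f, pderiv i (aeval ![W4, psi6] f) =
      aeval ![W4, psi6] (pderiv 0 f) * pderiv i W4 +
        aeval ![W4, psi6] (pderiv 1 f) * pderiv i psi6 :=
    fun i f => pderiv_aeval_pair W4 psi6 f i
  have a0 : aeval ![W4, psi6] (X 0 : MvPolynomial (Fin 2) ℂ) = W4 := by simp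
  have a1 : aeval ![W4, psi6] (X 1 : MvPolynomial (Fin 2) ℂ) = psi6 := by simp
  rw [quarticOp_eq, pderiv_iterate_three_aeval_pair, pderiv_iterate_three_aeval_pair]
  simp only [ux, uy, vx, vy, uxx, uyy, vxx, vyy, uxxx, uyyy, vxxx, vyyy, map_add, map_sub, map_mul,
    map_pow, map_ofNat, a0, a1, Derivation.leibniz, Derivation.leibniz_pow, map_neg, n0, x00, x01,
    smul_eq_mul, nsmul_eq_mul, Nat.cast_ofNat, Nat.add_one_sub_one, ch, cm]
  simp only [W4, psi6]
  ring

theorem quarticOp_mem_adjoin {W : MvPolynomial (Fin 2) ℂ}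
    (h : W ∈ Algebra.adjoin ℂ ({W4, psi6} : Set (MvPolynomial (Fin 2) ℂ))) :
    quarticOp W ∈ Algebra.adjoin ℂ ({W4, psi6} : Set (MvPolynomial (Fin 2) ℂ)) := by
  rw [← Matrix.range_cons_cons_empty W4 psi6 ![], Algebra.adjoin_range_eq_range_aeval] at h ⊢
  obtain ⟨f, rfl⟩ := h
  exact ⟨_, (quarticOp_aeval f).symm⟩

/-! ### Homogeneous elements of the ring and the MacWilliams transform -/

/-- A homogeneous element of `ℂ[W_4, ψ_6]` of degree `N` is a combination of the monomials
`W_4^a ψ_6^b` with `4a + 6b = N`. -/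
theorem exists_sum_of_mem_adjoin {F : MvPolynomial (Fin 2) ℂ} {N : ℕ}
    (h : F ∈ Algebra.adjoin ℂ ({W4, psi6} : Set (MvPolynomial (Fin 2) ℂ)))
    (hF : F.IsHomogeneous N) :
    ∃ (s : Finset (Fin 2 →₀ ℕ)) (c : (Fin 2 →₀ ℕ) → ℂ), (∀ m ∈ s, 4 * m 0 + 6 * m 1 = N) ∧
      F = ∑ m ∈ s, C (c m) * W4 ^ m 0 * psi6 ^ m 1 := by
  rw [← Matrix.range_cons_cons_empty W4 psi6 ![], Algebra.adjoin_range_eq_range_aeval] at h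
  obtain ⟨f, rfl⟩ : ∃ f : MvPolynomial (Fin 2) ℂ, aeval ![W4, psi6] f = F := h
  have e0 : (X 0 : MvPolynomial (Fin 2) ℂ).IsHomogeneous 1 := isHomogeneous_X _ _
  have e1 : (X 1 : MvPolynomial (Fin 2) ℂ).IsHomogeneous 1 := isHomogeneous_X _ _
  have n8 : (8 : MvPolynomial (Fin 2) ℂ).IsHomogeneous 0 := isHomogeneous_C _ 8
  have n20 : (20 : MvPolynomial (Fin 2) ℂ).IsHomogeneous 0 := isHomogeneous_C _ 20
  have hW : W4.IsHomogeneous 4 := (e0.pow 4).add ((n8.mul e0).mul (e1.pow 3))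
  have hpsi : psi6.IsHomogeneous 6 :=
    ((e0.pow 6).sub ((n20.mul (e0.pow 3)).mul (e1.pow 3))).sub (n8.mul (e1.pow 6))
  refine ⟨f.support.filter fun m => 4 * m 0 + 6 * m 1 = N, fun m => coeff m f,
    fun m hm => (Finset.mem_filter.1 hm).2, ?_⟩
  have hf : aeval ![W4, psi6] f =
      ∑ m ∈ f.support, C (coeff m f) * W4 ^ m 0 * psi6 ^ m 1 := by
    rw [aeval_def, eval₂_eq']
    simp [Fin.prod_univ_two, mul_assoc, algebraMap_eq]
  -- Taking the component of degree `N` discards exactly the monomials of other weights.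
  rw [← homogeneousComponent_eq_self hF, hf, map_sum, Finset.sum_filter]
  refine Finset.sum_congr rfl fun m _ => ?_
  have hm : (C (coeff m f) * W4 ^ m 0 * psi6 ^ m 1).IsHomogeneous (4 * m 0 + 6 * m 1) :=
    ((hW.pow _).C_mul _).mul (hpsi.pow _)
  simp only [homogeneousComponent_of_mem hm, eq_comm]

theorem C_inv_sqrt_three_sq :
    3 * C ((Real.sqrt 3 : ℂ)⁻¹) ^ 2 = (1 : MvPolynomial (Fin 2) ℂ) := by
  have hr : (Real.sqrt 3 : ℂ) ^ 2 = 3 := by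
    rw [← Complex.ofReal_pow, Real.sq_sqrt (by norm_num)]; norm_num
  rw [← C_pow, inv_pow, hr, ← map_ofNat (C : ℂ →+* MvPolynomial (Fin 2) ℂ), ← C_mul]
  norm_num

theorem linearAction_macWilliams (q : ℝ) (F : MvPolynomial (Fin 2) ℂ) :
    linearAction (macWilliams q) F = aeval ![C ((Real.sqrt q : ℂ)⁻¹) * (X 0 + C (q - 1 : ℂ) * X 1),
      C ((Real.sqrt q : ℂ)⁻¹) * (X 0 - X 1)] F := by
  rw [linearAction]
  congr 2
  simp [macWilliams]
  constructor <;> ring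

theorem linearAction_W4 : linearAction (macWilliams 3) W4 = W4 := by
  have h2 : C (((3 : ℝ) : ℂ) - 1) = (2 : MvPolynomial (Fin 2) ℂ) := by
    rw [← map_ofNat (C : ℂ →+* MvPolynomial (Fin 2) ℂ)]; norm_num
  rw [linearAction_macWilliams, h2, W4]
  simp only [map_add, map_mul, map_pow, map_ofNat, aeval_X, Matrix.cons_val_zero,
    Matrix.cons_val_one]
  -- With `c = 1/√3` the image is `9c^4 W_4`, and `9c^4 - 1 = (3c^2+1)(3c^2-1)`.
  linear_combination (3 * C ((Real.sqrt 3 : ℂ)⁻¹) ^ 2 + 1) * (X 0 ^ 4 + 8 * X 0 * X 1 ^ 3) *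
    C_inv_sqrt_three_sq

theorem linearAction_psi6 : linearAction (macWilliams 3) psi6 = -psi6 := by
  have h2 : C (((3 : ℝ) : ℂ) - 1) = (2 : MvPolynomial (Fin 2) ℂ) := by
    rw [← map_ofNat (C : ℂ →+* MvPolynomial (Fin 2) ℂ)]; norm_num
  rw [linearAction_macWilliams, h2, psi6]
  simp only [map_sub, map_mul, map_pow, map_ofNat, aeval_X, Matrix.cons_val_zero,
    Matrix.cons_val_one]
  -- The image is `-27c^6 ψ_6`, and `27c^6 - 1 = (9c^4+3c^2+1)(3c^2-1)`.
  linear_combination (-(9 * C ((Real.sqrt 3 : ℂ)⁻¹) ^ 4 + 3 * C ((Real.sqrt 3 : ℂ)⁻¹) ^ 2 + 1)) *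
    (X 0 ^ 6 - 20 * X 0 ^ 3 * X 1 ^ 3 - 8 * X 1 ^ 6) * C_inv_sqrt_three_sq

/-- A homogeneous element of `ℂ[W_4, ψ_6]` whose degree is `2` modulo `4` changes its sign under
the MacWilliams transform. -/
theorem linearAction_eq_neg {F : MvPolynomial (Fin 2) ℂ} {N : ℕ}
    (h : F ∈ Algebra.adjoin ℂ ({W4, psi6} : Set (MvPolynomial (Fin 2) ℂ)))
    (hF : F.IsHomogeneous N) (hN : N % 4 = 2) : linearAction (macWilliams 3) F = -F := by
  obtain ⟨s, c, hs, rfl⟩ := exists_sum_of_mem_adjoin h hF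
  have e : ∀ F G, linearAction (macWilliams 3) (F * G) =
      linearAction (macWilliams 3) F * linearAction (macWilliams 3) G := fun _ _ => map_mul _ _ _
  have ep : ∀ F (a : ℕ), linearAction (macWilliams 3) (F ^ a) =
      linearAction (macWilliams 3) F ^ a := fun _ _ => map_pow _ _ _
  have eC : ∀ a : ℂ, linearAction (macWilliams 3) (C a) = C a := fun a => by
    simp [linearAction]
  have es : ∀ t : (Fin 2 →₀ ℕ) → MvPolynomial (Fin 2) ℂ,
      linearAction (macWilliams 3) (∑ m ∈ s, t m) = ∑ m ∈ s, linearAction (macWilliams 3) (t m) :=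
    fun _ => map_sum _ _ _
  rw [es, ← Finset.sum_neg_distrib]
  refine Finset.sum_congr rfl fun m hm => ?_
  -- `4a + 6b ≡ 2` modulo `4` makes `b` odd.
  have hodd : Odd (m 1) := by
    have := hs m hm
    rw [Nat.odd_iff]; omega
  rw [e, e, ep, ep, eC, linearAction_W4, linearAction_psi6, hodd.neg_pow, mul_neg]

/-! ### Uniqueness of the extremal enumerator -/

/-- Setting `x = 1` in a homogeneous polynomial does not lose any coefficient. -/
theorem coeff_aeval_one_X {E : MvPolynomial (Fin 2) ℂ} {N b : ℕ} (hE : E.IsHomogeneous N)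
    (hb : b ≤ N) : PowerSeries.coeff b (aeval ![1, (PowerSeries.X : PowerSeries ℂ)] E) =
      coeff (expo (N - b) b) E := by
  rw [aeval_def, eval₂_eq', map_sum]
  have : ∀ m ∈ E.support, PowerSeries.coeff b (algebraMap ℂ (PowerSeries ℂ) (coeff m E) *
      ∏ i, ![1, (PowerSeries.X : PowerSeries ℂ)] i ^ m i) =
      if expo (N - b) b = m then coeff m E else 0 := by
    intro m hm
    have hd : m 0 + m 1 = N := by
      by_contra hne
      refine mem_support_iff.1 hm (hE.coeff_eq_zero ?_)
      rwa [eq_expo m, degree_expo]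
    have e : expo (N - b) b = m ↔ b = m 1 := by
      conv_lhs => rw [eq_expo m, expo_inj]
      omega
    simp [Fin.prod_univ_two, PowerSeries.coeff_C_mul, PowerSeries.coeff_X_pow, e]
  rw [Finset.sum_congr rfl this, Finset.sum_ite_eq]
  split_ifs with h
  · rfl
  · exact (notMem_support_iff.1 h).symm

/-- As `s - 1` is `X^3` times a unit, the order of `g(s)` for `g ≠ 0` is three times the
multiplicity of `1` as a root of `g`, hence at most `3 deg g < 3k`. -/
theorem eq_zero_of_X_pow_dvd_aeval {g : Polynomial ℂ} {s w : PowerSeries ℂ} {k : ℕ}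
    (hs : s - 1 = PowerSeries.X ^ 3 * w) (hw : PowerSeries.constantCoeff w ≠ 0)
    (hk : g.natDegree < k) (h : PowerSeries.X ^ (3 * k) ∣ Polynomial.aeval s g) : g = 0 := by
  by_contra hg
  obtain ⟨p, hp, hnd⟩ := Polynomial.exists_eq_pow_rootMultiplicity_mul_and_not_dvd g hg 1
  set r := g.rootMultiplicity 1
  have hr : r ≤ g.natDegree := by
    have := Polynomial.natDegree_le_of_dvd (Polynomial.pow_rootMultiplicity_dvd g 1) hg
    rwa [Polynomial.natDegree_pow, Polynomial.natDegree_X_sub_C, mul_one] at this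
  have e : Polynomial.aeval s g =
      PowerSeries.X ^ (3 * r) * (w ^ r * Polynomial.aeval s p) := by
    conv_lhs => rw [hp]
    rw [map_mul, map_pow, map_sub, Polynomial.aeval_X, Polynomial.aeval_C, map_one, hs, mul_pow,
      pow_mul, mul_assoc]
  have hX : (PowerSeries.X : PowerSeries ℂ) ∣ w ^ r * Polynomial.aeval s p := by
    have h' := (pow_dvd_pow (PowerSeries.X : PowerSeries ℂ)
      (show 3 * r + 1 ≤ 3 * k by omega)).trans h
    rw [e, pow_succ] at h'
    exact (mul_dvd_mul_iff_left (pow_ne_zero _ PowerSeries.X_ne_zero)).1 h'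
  have hs1 : PowerSeries.constantCoeff s = 1 := by
    have := congrArg PowerSeries.constantCoeff hs
    simpa [sub_eq_zero] using this
  have hcp : PowerSeries.constantCoeff (Polynomial.aeval s p) = p.eval 1 := by
    rw [Polynomial.aeval_def, Polynomial.hom_eval₂, hs1, Polynomial.eval]
    congr 1
  rw [PowerSeries.X_dvd_iff, map_mul, map_pow, hcp] at hX
  refine hnd (Polynomial.dvd_iff_isRoot.2 ?_)
  exact (mul_eq_zero.1 hX).resolve_left (pow_ne_zero _ hw)

/-- A homogeneous element of `ℂ[W_4, ψ_6]` of degree `12k + 2` vanishes if it is divisible by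
`y^{3k}`. -/
theorem eq_zero_of_coeff_eq_zero {E : MvPolynomial (Fin 2) ℂ} {k : ℕ}
    (h : E ∈ Algebra.adjoin ℂ ({W4, psi6} : Set (MvPolynomial (Fin 2) ℂ)))
    (hE : E.IsHomogeneous (12 * k + 2))
    (hz : ∀ b < 3 * k, coeff (expo (12 * k + 2 - b) b) E = 0) : E = 0 := by
  obtain ⟨t, c, ht, hEt⟩ := exists_sum_of_mem_adjoin h hE
  set θ := aeval (R := ℂ) ![1, (PowerSeries.X : PowerSeries ℂ)] with hθ
  set U : PowerSeries ℂ := 1 + 8 * PowerSeries.X ^ 3 with hU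
  set V : PowerSeries ℂ := 1 - 20 * PowerSeries.X ^ 3 - 8 * PowerSeries.X ^ 6 with hV
  have hU0 : PowerSeries.constantCoeff U = 1 := by simp [hU]
  have hV0 : PowerSeries.constantCoeff V = 1 := by simp [hV]
  have hθU : θ W4 = U := by
    simp [hθ, W4, hU]
  have hθV : θ psi6 = V := by
    simp [hθ, psi6, hV]
  clear_value U V
  have hSS : U ^ 3 * (U ^ 3)⁻¹ = 1 := PowerSeries.mul_inv_cancel _ (by simp [hU0])
  set s : PowerSeries ℂ := V ^ 2 * (U ^ 3)⁻¹ with hs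
  set g : Polynomial ℂ := ∑ m ∈ t, Polynomial.C (c m) * Polynomial.X ^ (m 1 / 2) with hg
  -- From `4a + 6b = 12k + 2` follow `b = 2j+1` and `a = 3(k-1-j) + 2`. So `U^2 V` divides every
  -- term, and what remains is homogeneous of degree `k-1` in `U^3` and `V^2`.
  have hθE : θ E = U ^ 2 * V * (U ^ 3) ^ (k - 1) * Polynomial.aeval s g := by
    rw [hEt, hg, map_sum, map_sum, Finset.mul_sum]
    refine Finset.sum_congr rfl fun m hm => ?_
    have hm' := ht m hm
    obtain ⟨j, hj⟩ : ∃ j, m 1 = 2 * j + 1 := ⟨m 1 / 2, by omega⟩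
    have hj0 : m 0 = 3 * (k - 1 - j) + 2 := by omega
    have hj1 : k - 1 = k - 1 - j + j := by omega
    rw [map_mul, map_mul, map_pow, map_pow, map_mul, map_pow, hθU, hθV, hj0, hj,
      show (2 * j + 1) / 2 = j by omega, Polynomial.aeval_X, Polynomial.aeval_C]
    have hc : θ (C (c m)) = algebraMap ℂ (PowerSeries ℂ) (c m) := aeval_C _ _
    have hps : (U ^ 3) ^ (k - 1) * s ^ j = (U ^ 3) ^ (k - 1 - j) * (V ^ 2) ^ j := by
      conv_lhs => rw [hj1]
      rw [pow_add, hs, mul_pow, mul_assoc, mul_left_comm ((U ^ 3) ^ j), ← mul_pow (U ^ 3), hSS,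
        one_pow, mul_one]
    rw [hc]
    linear_combination (-(algebraMap ℂ (PowerSeries ℂ) (c m) * U ^ 2 * V)) * hps
  have hg0 : g = 0 := by
    -- For `k = 0` the degree is `2` and there are no monomials at all.
    rcases Nat.eq_zero_or_pos k with rfl | hk
    · rw [hg]
      refine Finset.sum_eq_zero fun m hm => ?_
      have := ht m hm
      omega
    refine eq_zero_of_X_pow_dvd_aeval (s := s) (k := k)
      (w := -64 * (1 - PowerSeries.X ^ 3) ^ 3 * (U ^ 3)⁻¹) ?_ ?_ ?_ ?_
    · have : s - 1 = (V ^ 2 - U ^ 3) * (U ^ 3)⁻¹ := by rw [sub_mul, hSS]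
      -- The dehomogenized identity `ψ_6^2 - W_4^3 = -64 y^3 (x^3 - y^3)^3`: the order at `y = 0` is
      -- exactly `3`.
      have hVU : V ^ 2 - U ^ 3 = PowerSeries.X ^ 3 * (-64 * (1 - PowerSeries.X ^ 3) ^ 3) := by
        rw [hU, hV]
        ring
      rw [this, hVU, mul_assoc]
    · have : PowerSeries.constantCoeff (64 : PowerSeries ℂ) = 64 := map_ofNat _ 64
      simp [hU0, this]
    · refine (Polynomial.natDegree_sum_le_of_forall_le t _ (n := k - 1) fun m hm => ?_).trans_lt
        (by omega)
      refine (Polynomial.natDegree_C_mul_X_pow_le _ _).trans ?_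
      have := ht m hm
      omega
    · have hdvd : PowerSeries.X ^ (3 * k) ∣ θ E := by
        rw [PowerSeries.X_pow_dvd_iff]
        intro b hb
        rw [hθ, coeff_aeval_one_X hE (by omega), hz b hb]
      rw [hθE] at hdvd
      have hunit : IsUnit (U ^ 2 * V * (U ^ 3) ^ (k - 1)) := by
        rw [PowerSeries.isUnit_iff_constantCoeff]
        simp [hU0, hV0]
      exact (hunit.dvd_mul_left).1 hdvd
  have hθ0 : θ E = 0 := by rw [hθE, hg0, map_zero, mul_zero]
  ext m
  rw [coeff_zero]
  by_cases hm : m 0 + m 1 = 12 * k + 2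
  · have := coeff_aeval_one_X hE (b := m 1) (by omega)
    rw [← hθ, hθ0, map_zero] at this
    rw [eq_expo m, this, show 12 * k + 2 - m 1 = m 0 by omega]
  · refine hE.coeff_eq_zero ?_
    rw [eq_expo m, degree_expo]
    exact hm

/-! ### The degree bound from MacWilliams duality -/

/-- The coefficients of the zeta series are the power moments of `W`. -/
theorem coeff_zetaSeries {q : ℝ} (hq1 : q ≠ 1) {n d : ℕ} {ε : ℂ}
    {W : MvPolynomial (Fin 2) ℂ} (h : HasForm n d W)
    (hW : W = C ε * linearAction (macWilliams q) W) {P : Polynomial ℂ}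
    (hP : IsZetaPolynomialAt q n d W P) {j : ℕ} (hj : j < d) (hjn : j ≤ n - d) :
    ((q : ℂ) - 1) * PowerSeries.coeff (n - d - j) (zetaSeries q P) =
      ε * (Real.sqrt q : ℂ)⁻¹ ^ n * q ^ (n - j) - 1 := by
  obtain ⟨h1, h2, A, hA, hWA⟩ := id h
  have hqc : (q : ℂ) - 1 ≠ 0 := by
    rw [sub_ne_zero]; exact_mod_cast hq1
  have hch : (n.choose j : ℂ) ≠ 0 := by
    exact_mod_cast (Nat.choose_pos (by omega)).ne'
  set r : ℂ := (Real.sqrt q : ℂ)⁻¹ with hr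
  -- At `x = 1+X`, `y = 1` the form `y(1-T) + xT` becomes `1 + XT`, so the coefficient of `X^j`
  -- isolates a single coefficient of the zeta series. The transformed variables become `r(X+q)` and
  -- `rX`.
  let g : MvPolynomial (Fin 2) ℂ →ₐ[ℂ] Polynomial ℂ := aeval ![1 + Polynomial.X, 1]
  have gX0 : g (X 0) = 1 + Polynomial.X := by simp [g]
  have gX1 : g (X 1) = 1 := by simp [g]
  have gC : ∀ a, g (C a) = Polynomial.C a := fun a => by simp [g]
  have hgW : (g W).coeff j = ε * r ^ n * (n.choose j * (q : ℂ) ^ (n - j)) := by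
    have e : g W = Polynomial.C ε *
        ((Polynomial.C r * (Polynomial.X + Polynomial.C (q : ℂ))) ^ n +
          ∑ i ∈ Finset.Icc d n, Polynomial.C (A i) *
            (Polynomial.C r * (Polynomial.X + Polynomial.C (q : ℂ))) ^ (n - i) *
            (Polynomial.C r * Polynomial.X) ^ i) := by
      rw [hW, map_mul, gC, linearAction_macWilliams, ← hr]
      conv_lhs => rw [hWA]
      have c0 : ∀ (v : Fin 2 → MvPolynomial (Fin 2) ℂ) (a : ℂ), aeval v (C a) = C a :=
        fun v a => by simp
      simp only [map_add, map_sum, map_mul, map_pow, c0, aeval_X, Matrix.cons_val_zero,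
        Matrix.cons_val_one, gC, gX0, gX1, map_sub, map_one]
      rw [show 1 + Polynomial.X + (Polynomial.C (q : ℂ) - 1) * 1 =
        Polynomial.X + Polynomial.C (q : ℂ) by ring, add_sub_cancel_left]
    -- Every term is divisible by `X^i` with `i ≥ d > j`, so only the image of `x^n` contributes.
    have hsum : (∑ i ∈ Finset.Icc d n, Polynomial.C (A i) *
        (Polynomial.C r * (Polynomial.X + Polynomial.C (q : ℂ))) ^ (n - i) *
        (Polynomial.C r * Polynomial.X) ^ i).coeff j = 0 := by
      rw [Polynomial.finsetSum_coeff]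
      refine Finset.sum_eq_zero fun i hi => ?_
      have := Finset.mem_Icc.1 hi
      rw [mul_pow _ Polynomial.X, ← mul_assoc, Polynomial.coeff_mul_X_pow', if_neg (by omega)]
    rw [e, Polynomial.coeff_C_mul, Polynomial.coeff_add, hsum, add_zero, mul_pow,
      ← Polynomial.C_pow, Polynomial.coeff_C_mul, Polynomial.coeff_X_add_C_pow]
    ring
  have hcoeff := congrArg (fun F => (g F).coeff j) hP.2
  have hL : ∀ F : PowerSeries (MvPolynomial (Fin 2) ℂ), g (PowerSeries.coeff (n - d) F) =
      PowerSeries.coeff (n - d) (PowerSeries.map (g : MvPolynomial (Fin 2) ℂ →+* _) F) :=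
    fun F => by simp
  have hmap : PowerSeries.map (g : MvPolynomial (Fin 2) ℂ →+* Polynomial ℂ)
      (PowerSeries.map (C : ℂ →+* MvPolynomial (Fin 2) ℂ) (zetaSeries q P) *
        (PowerSeries.C (X 1 : MvPolynomial (Fin 2) ℂ) * (1 - PowerSeries.X) +
          PowerSeries.C (X 0 : MvPolynomial (Fin 2) ℂ) * PowerSeries.X) ^ n) =
      ∑ l ∈ Finset.range (n + 1), PowerSeries.C (Polynomial.X ^ l * (n.choose l : Polynomial ℂ)) *
        (PowerSeries.X ^ l *
          PowerSeries.map (Polynomial.C : ℂ →+* Polynomial ℂ) (zetaSeries q P)) := by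
    have hC : PowerSeries.map (g : MvPolynomial (Fin 2) ℂ →+* Polynomial ℂ)
        (PowerSeries.map (C : ℂ →+* MvPolynomial (Fin 2) ℂ) (zetaSeries q P)) =
        PowerSeries.map (Polynomial.C : ℂ →+* Polynomial ℂ) (zetaSeries q P) := by
      ext i : 1
      simp only [PowerSeries.coeff_map]
      exact gC _
    have hlin : PowerSeries.map (g : MvPolynomial (Fin 2) ℂ →+* Polynomial ℂ)
        (PowerSeries.C (X 1 : MvPolynomial (Fin 2) ℂ) * (1 - PowerSeries.X) +
          PowerSeries.C (X 0 : MvPolynomial (Fin 2) ℂ) * PowerSeries.X) =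
        PowerSeries.C Polynomial.X * PowerSeries.X + 1 := by
      simp only [map_add, map_mul, map_sub, map_one, PowerSeries.map_C, PowerSeries.map_X,
        RingHom.coe_coe, gX0, gX1]
      ring
    rw [map_mul, map_pow, hC, hlin, add_pow, Finset.mul_sum]
    refine Finset.sum_congr rfl fun l _ => ?_
    simp only [mul_pow, map_mul, map_pow, map_natCast, one_pow]
    ring
  have hl : ∀ l, (PowerSeries.coeff (n - d)
      (PowerSeries.C (Polynomial.X ^ l * (n.choose l : Polynomial ℂ)) * (PowerSeries.X ^ l *
        PowerSeries.map (Polynomial.C : ℂ →+* Polynomial ℂ) (zetaSeries q P)))).coeff j =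
      if l = j then n.choose j * PowerSeries.coeff (n - d - j) (zetaSeries q P) else 0 := by
    intro l
    rw [PowerSeries.coeff_C_mul, PowerSeries.coeff_X_pow_mul']
    by_cases hle : l ≤ n - d
    · rw [if_pos hle, PowerSeries.coeff_map, mul_assoc, ← Polynomial.C_eq_natCast,
        ← Polynomial.C_mul, Polynomial.coeff_X_pow_mul', Polynomial.coeff_C]
      by_cases hlj : l = j
      · subst hlj; simp
      · rw [if_neg hlj]
        split_ifs <;> first | rfl | omega
    · rw [if_neg hle, mul_zero, Polynomial.coeff_zero, if_neg (by omega)]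
  have hR : (g (X 0 ^ n)).coeff j = n.choose j := by
    rw [map_pow, gX0, Polynomial.coeff_one_add_X_pow]
  simp only [hL, hmap, map_sum, Polynomial.finsetSum_coeff, hl] at hcoeff
  rw [Finset.sum_ite_eq', if_pos (Finset.mem_range.2 (by omega)), map_mul, gC,
    Polynomial.coeff_C_mul, map_sub, Polynomial.coeff_sub, hgW, hR] at hcoeff
  apply mul_left_cancel₀ hch
  rw [mul_left_comm, hcoeff, one_div, mul_inv_cancel_left₀ hqc]
  ring

/-- The zeta polynomial of a polynomial that is an eigenvector of the MacWilliams transform has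
degree at most `n + 2 - 2d`. -/
theorem coeff_zetaPolynomial_eq_zero {q : ℝ} (hq1 : q ≠ 1) {n d : ℕ} {ε : ℂ}
    {W : MvPolynomial (Fin 2) ℂ} (h : HasForm n d W)
    (hW : W = C ε * linearAction (macWilliams q) W) {P : Polynomial ℂ}
    (hP : IsZetaPolynomialAt q n d W P) {j : ℕ} (hj : j + 2 < d) (hjn : j + 2 ≤ n - d) :
    P.coeff (n - d - j) = 0 := by
  have h0 := coeff_zetaSeries hq1 h hW hP (j := j) (by omega) (by omega)
  have h1 := coeff_zetaSeries hq1 h hW hP (j := j + 1) (by omega) (by omega)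
  have h2 := coeff_zetaSeries hq1 h hW hP (j := j + 2) (by omega) (by omega)
  have hqc : (q : ℂ) - 1 ≠ 0 := by
    rw [sub_ne_zero]; exact_mod_cast hq1
  obtain ⟨N, hN⟩ : ∃ N, n - d - j = N + 2 := ⟨n - d - j - 2, by omega⟩
  obtain ⟨M, hM⟩ : ∃ M, n - j = M + 2 := ⟨n - j - 2, by omega⟩
  rw [hN, hM] at h0
  rw [show n - d - (j + 1) = N + 1 by omega, show n - (j + 1) = M + 1 by omega] at h1
  rw [show n - d - (j + 2) = N by omega, show n - (j + 2) = M by omega] at h2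
  -- Comparison of coefficients in `P = (1 - (1+q)T + qT^2) Z`.
  have e : PowerSeries.coeff (N + 2) (P : PowerSeries ℂ) =
      PowerSeries.coeff (N + 2) (zetaSeries q P) -
        (1 + q) * PowerSeries.coeff (N + 1) (zetaSeries q P) +
        q * PowerSeries.coeff N (zetaSeries q P) := by
    have e' : zetaSeries q P *
        ((1 - PowerSeries.X) * (1 - PowerSeries.C (q : ℂ) * PowerSeries.X)) =
        zetaSeries q P - PowerSeries.C (1 + q : ℂ) * (zetaSeries q P * PowerSeries.X) +
          PowerSeries.C (q : ℂ) * (zetaSeries q P * PowerSeries.X ^ 2) := by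
      rw [map_add, map_one]
      ring
    rw [← zetaSeries_mul q P, e', map_add, map_sub, PowerSeries.coeff_C_mul,
      PowerSeries.coeff_C_mul, PowerSeries.coeff_succ_mul_X, PowerSeries.coeff_mul_X_pow]
  rw [hN, ← Polynomial.coeff_coe, e]
  apply mul_left_cancel₀ hqc
  -- By `coeff_zetaSeries` these coefficients combine a constant sequence and powers of `q`; both
  -- are annihilated, since `1` and `q` are the roots of `t^2 - (1+q)t + q`.
  linear_combination h0 - (1 + q) * h1 + q * h2

/-- The vanishing for `j ≤ d-3` covers the indices from `n+3-2d` to `n-d`; `2d ≤ n+1` keeps them at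
least `2`, as the three-term recurrence requires. -/
theorem natDegree_zetaPolynomial_le {q : ℝ} (hq1 : q ≠ 1) {n d : ℕ} {ε : ℂ}
    {W : MvPolynomial (Fin 2) ℂ} (h : HasForm n d W)
    (hW : W = C ε * linearAction (macWilliams q) W) {P : Polynomial ℂ}
    (hP : IsZetaPolynomialAt q n d W P) (hd : 2 ≤ d) (hdn : 2 * d ≤ n + 1) :
    P.natDegree ≤ n + 2 - 2 * d := by
  rw [Polynomial.natDegree_le_iff_coeff_eq_zero]
  intro N hN
  by_cases hNd : N ≤ n - d
  · have := coeff_zetaPolynomial_eq_zero hq1 h hW hP (j := n - d - N) (by omega) (by omega)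
    rwa [show n - d - (n - d - N) = N by omega] at this
  · exact Polynomial.coeff_eq_zero_of_natDegree_lt (hP.1.trans_lt (by omega))

/-! ### The operator on the generating series -/

/-- The coefficientwise extension of a derivation to power series. -/
noncomputable def coeffwiseDerivation {A R : Type*} [CommRing A] [CommRing R] [Algebra A R]
    (δ : Derivation A R R) : Derivation A (PowerSeries R) (PowerSeries R) :=
  Derivation.mk'
    { toFun := fun F => PowerSeries.mk fun i => δ (PowerSeries.coeff i F)
      map_add' := fun F G => by ext; simp
      map_smul' := fun c F => by
        ext i
        rw [PowerSeries.coeff_mk]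
        change δ (c • PowerSeries.coeff i F) =
          c • PowerSeries.coeff i (PowerSeries.mk fun i => δ (PowerSeries.coeff i F))
        rw [PowerSeries.coeff_mk, δ.map_smul] } fun F G => by
    ext i
    simp only [LinearMap.coe_mk, AddHom.coe_mk, PowerSeries.coeff_mk, smul_eq_mul, map_add,
      PowerSeries.coeff_mul, map_sum, Derivation.leibniz, Finset.sum_add_distrib]
    congr 1
    exact (Finset.Nat.sum_antidiagonal_swap
      (f := fun x => PowerSeries.coeff x.2 G * δ (PowerSeries.coeff x.1 F))).symm

section

variable {A R : Type*} [CommRing A] [CommRing R] [Algebra A R] (δ : Derivation A R R)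

theorem coeff_coeffwiseDerivation (F : PowerSeries R) (i : ℕ) :
    PowerSeries.coeff i (coeffwiseDerivation δ F) = δ (PowerSeries.coeff i F) := by
  simp [coeffwiseDerivation]

theorem coeffwiseDerivation_C (a : R) :
    coeffwiseDerivation δ (PowerSeries.C a) = PowerSeries.C (δ a) := by
  ext i
  rw [coeff_coeffwiseDerivation, PowerSeries.coeff_C, PowerSeries.coeff_C]
  split_ifs <;> simp

theorem coeffwiseDerivation_X : coeffwiseDerivation δ PowerSeries.X = 0 := by
  ext i
  rw [coeff_coeffwiseDerivation, PowerSeries.coeff_X]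
  split_ifs <;> simp

theorem Derivation.leibniz_mul_pow_of_eq_zero {a b M : R} (n : ℕ) (ha : δ a = 0) (hb : δ b = M) :
    δ (a * b ^ n) = n * a * M * b ^ (n - 1) := by
  rw [δ.leibniz, ha, smul_zero, add_zero, δ.leibniz_pow, hb]
  simp only [smul_eq_mul, nsmul_eq_mul]
  ring

/-- On powers of `L` each derivation lowers the exponent and multiplies by the constant `T` or
`1-T`; thus the operator acts through its symbol `T(T^3 + (1-T)^3)`. -/
theorem Derivation.quartic_mul_pow {δ₀ δ₁ : Derivation A R R} {K L T : R} (hK₀ : δ₀ K = 0)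
    (hK₁ : δ₁ K = 0) (hT₀ : δ₀ T = 0) (hT₁ : δ₁ T = 0) (hL₀ : δ₀ L = T) (hL₁ : δ₁ L = 1 - T)
    (N : ℕ) :
    δ₀ (δ₀ (δ₀ (δ₀ (K * L ^ (N + 4)))) + δ₁ (δ₁ (δ₁ (K * L ^ (N + 4))))) =
      (N + 1) * (N + 2) * (N + 3) * (N + 4) * (T * (K * (1 - 3 * T + 3 * T ^ 2) * L ^ N)) := by
  -- The shape `c K T^a (1-T)^b L^n` is stable under both derivations, so each differentiation is
  -- one rewrite.
  have hK' : ∀ δ : Derivation A R R, δ K = 0 → δ T = 0 → ∀ c a b : ℕ,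
      δ (c * (K * T ^ a * (1 - T) ^ b)) = 0 := by
    intro δ hK hT c a b
    simp only [Derivation.leibniz, Derivation.leibniz_pow, hK, hT, map_sub,
      Derivation.map_one_eq_zero, Derivation.map_natCast, smul_zero, sub_zero, add_zero]
  have h0 : ∀ c a b n : ℕ, δ₀ (c * (K * T ^ a * (1 - T) ^ b) * L ^ (n + 1)) =
      ((c * (n + 1) : ℕ) : R) * (K * T ^ (a + 1) * (1 - T) ^ b) * L ^ n := by
    intro c a b n
    rw [Derivation.leibniz_mul_pow_of_eq_zero _ _ (hK' δ₀ hK₀ hT₀ c a b) hL₀, Nat.add_sub_cancel]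
    push_cast
    ring
  have h1 : ∀ c a b n : ℕ, δ₁ (c * (K * T ^ a * (1 - T) ^ b) * L ^ (n + 1)) =
      ((c * (n + 1) : ℕ) : R) * (K * T ^ a * (1 - T) ^ (b + 1)) * L ^ n := by
    intro c a b n
    rw [Derivation.leibniz_mul_pow_of_eq_zero _ _ (hK' δ₁ hK₁ hT₁ c a b) hL₁, Nat.add_sub_cancel]
    push_cast
    ring
  have hstart : K * L ^ (N + 4) =
      ((1 : ℕ) : R) * (K * T ^ 0 * (1 - T) ^ 0) * L ^ (N + 3 + 1) := by
    simp
  rw [hstart, h0 1 0 0 (N + 3), h0 _ 1 0 (N + 2), h0 _ 2 0 (N + 1), h1 1 0 0 (N + 3),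
    h1 _ 0 1 (N + 2), h1 _ 0 2 (N + 1), map_add, h0 _ _ _ N, h0 _ _ _ N]
  push_cast
  ring

end

theorem quarticOp_coeff (F : PowerSeries (MvPolynomial (Fin 2) ℂ)) (m : ℕ) :
    quarticOp (PowerSeries.coeff m F) = PowerSeries.coeff m
      (coeffwiseDerivation (pderiv 0) (coeffwiseDerivation (pderiv 0) (coeffwiseDerivation (pderiv 0) (coeffwiseDerivation (pderiv 0) F)) +
        coeffwiseDerivation (pderiv 1) (coeffwiseDerivation (pderiv 1) (coeffwiseDerivation (pderiv 1) F)))) := by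
  simp only [coeff_coeffwiseDerivation, map_add, quarticOp_eq]

/-- The effect of `∂_x (∂_x^3 + ∂_y^3)` on the generating series of the zeta polynomial. -/
theorem quarticOp_coeff_zeta (Z : PowerSeries ℂ) (N m : ℕ) :
    quarticOp (PowerSeries.coeff (m + 1)
      (PowerSeries.map (C : ℂ →+* MvPolynomial (Fin 2) ℂ) Z *
        (PowerSeries.C (X 1 : MvPolynomial (Fin 2) ℂ) * (1 - PowerSeries.X) +
          PowerSeries.C (X 0 : MvPolynomial (Fin 2) ℂ) * PowerSeries.X) ^ (N + 4))) =
    C ((N + 1) * (N + 2) * (N + 3) * (N + 4) : ℂ) * PowerSeries.coeff m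
      (PowerSeries.map (C : ℂ →+* MvPolynomial (Fin 2) ℂ)
          (Z * (1 - 3 * PowerSeries.X + 3 * PowerSeries.X ^ 2)) *
        (PowerSeries.C (X 1 : MvPolynomial (Fin 2) ℂ) * (1 - PowerSeries.X) +
          PowerSeries.C (X 0 : MvPolynomial (Fin 2) ℂ) * PowerSeries.X) ^ N) := by
  set K := PowerSeries.map (C : ℂ →+* MvPolynomial (Fin 2) ℂ) Z with hK
  set L := PowerSeries.C (X 1 : MvPolynomial (Fin 2) ℂ) * (1 - PowerSeries.X) +
    PowerSeries.C (X 0 : MvPolynomial (Fin 2) ℂ) * PowerSeries.X with hL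
  have hδX : ∀ i : Fin 2, coeffwiseDerivation (pderiv (R := ℂ) i) PowerSeries.X = 0 := fun i => coeffwiseDerivation_X _
  have hδK : ∀ i, coeffwiseDerivation (pderiv i) K = 0 := fun i => by
    ext j : 1
    rw [coeff_coeffwiseDerivation, hK, PowerSeries.coeff_map, map_zero]
    exact pderiv_C
  have hδC : ∀ i j, coeffwiseDerivation (pderiv i) (PowerSeries.C (X j : MvPolynomial (Fin 2) ℂ)) =
      PowerSeries.C (pderiv i (X j)) := fun i j => coeffwiseDerivation_C _ _
  have x01 : pderiv 0 (X 1 : MvPolynomial (Fin 2) ℂ) = 0 := pderiv_X_of_ne (by decide)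
  have x10 : pderiv 1 (X 0 : MvPolynomial (Fin 2) ℂ) = 0 := pderiv_X_of_ne (by decide)
  have hL0 : coeffwiseDerivation (pderiv 0) L = PowerSeries.X := by
    rw [hL]
    simp only [map_add, map_sub, Derivation.leibniz, hδC, hδX, x01, pderiv_X_self, smul_eq_mul,
      Derivation.map_one_eq_zero, map_zero, map_one]
    ring
  have hL1 : coeffwiseDerivation (pderiv 1) L = 1 - PowerSeries.X := by
    rw [hL]
    simp only [map_add, map_sub, Derivation.leibniz, hδC, hδX, x10, pderiv_X_self, smul_eq_mul,
      Derivation.map_one_eq_zero, map_zero, map_one]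
    ring
  have hmap : PowerSeries.map (C : ℂ →+* MvPolynomial (Fin 2) ℂ)
      (Z * (1 - 3 * PowerSeries.X + 3 * PowerSeries.X ^ 2)) =
      K * (1 - 3 * PowerSeries.X + 3 * PowerSeries.X ^ 2) := by
    simp only [map_mul, map_add, map_sub, map_one, map_pow, map_ofNat, PowerSeries.map_X, hK]
  have hC : (PowerSeries.C (C ((N + 1) * (N + 2) * (N + 3) * (N + 4) : ℂ)) :
      PowerSeries (MvPolynomial (Fin 2) ℂ)) =
      (N + 1) * (N + 2) * (N + 3) * (N + 4) := by
    simp only [map_mul, map_add, map_one, map_natCast, map_ofNat]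
  rw [quarticOp_coeff, Derivation.quartic_mul_pow (hδK 0) (hδK 1) (hδX 0) (hδX 1) hL0 hL1, hmap,
    mul_left_comm, PowerSeries.coeff_succ_X_mul, ← hC, PowerSeries.coeff_C_mul]

/-- Apply the operator to the defining identity of `P`. The new degree bound is `(n-4)-(d-3) =
n-d-1`, and the quadratic factor adds `2`, whence the margin of `3` in `hdeg`. -/
theorem IsZetaPolynomialAt.quarticOp {q : ℝ} {n d : ℕ} {W : MvPolynomial (Fin 2) ℂ}
    {P : Polynomial ℂ} (hP : IsZetaPolynomialAt q n d W P) (hn : 4 ≤ n) (hd : 3 ≤ d) (hdn : d < n)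
    (hdeg : P.natDegree + 3 ≤ n - d) :
    IsZetaPolynomialAt q (n - 4) (d - 3)
      (C (1 / (ascPochhammer ℂ 4).eval ((n : ℂ) - 3)) * quarticOp W)
      ((3 * Polynomial.X ^ 2 - 3 * Polynomial.X + 1) * P) := by
  obtain ⟨N, rfl⟩ : ∃ N, n = N + 4 := ⟨n - 4, by omega⟩
  obtain ⟨m, hm⟩ : ∃ m, N + 4 - d = m + 1 := ⟨N + 3 - d, by omega⟩
  have hp0 : ((N + 1) * (N + 2) * (N + 3) * (N + 4) : ℂ) ≠ 0 := by
    norm_cast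
  have hz : zetaSeries q ((3 * Polynomial.X ^ 2 - 3 * Polynomial.X + 1) * P) =
      zetaSeries q P * (1 - 3 * PowerSeries.X + 3 * PowerSeries.X ^ 2) := by
    have e : (((3 * Polynomial.X ^ 2 - 3 * Polynomial.X + 1) * P : Polynomial ℂ) :
        PowerSeries ℂ) = (3 * PowerSeries.X ^ 2 - 3 * PowerSeries.X + 1) * (P : PowerSeries ℂ) := by
      rw [← Polynomial.coeToPowerSeries.ringHom_apply]
      simp only [map_mul, map_add, map_sub, map_pow, map_one, map_ofNat,
        Polynomial.coeToPowerSeries.ringHom_apply, Polynomial.coe_X]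
    rw [zetaSeries, zetaSeries, e]
    ring
  have hq := congrArg _root_.quarticOp hP.2
  rw [hm, quarticOp_coeff_zeta, ← hz] at hq
  refine ⟨?_, ?_⟩
  · refine Polynomial.natDegree_mul_le.trans ?_
    have : (3 * Polynomial.X ^ 2 - 3 * Polynomial.X + 1 : Polynomial ℂ).natDegree ≤ 2 := by
      compute_degree
    omega
  · rw [show N + 4 - 4 - (d - 3) = m by omega, Nat.add_sub_cancel, eval_ascPochhammer_four]
    have hlin : ∀ (c : ℂ) F, _root_.quarticOp (C c * F) = C c * _root_.quarticOp F := by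
      intro c F
      simp only [quarticOp_eq, pderiv_C_mul, map_add, mul_add]
    -- After normalization the subtracted `x^n` turns into exactly `x^{n-4}`.
    have hx : _root_.quarticOp (X 0 ^ (N + 4)) =
        C ((N + 1) * (N + 2) * (N + 3) * (N + 4) : ℂ) * X 0 ^ N := by
      have hx0 : ∀ (c : ℂ) (l : ℕ), pderiv 0 (C c * X 0 ^ (l + 1) : MvPolynomial (Fin 2) ℂ) =
          C (c * (l + 1)) * X 0 ^ l := by
        intro c l
        rw [pderiv_C_mul, pderiv_pow, pderiv_X_self, C_mul, Nat.add_sub_cancel]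
        simp only [map_add, map_natCast, map_one]
        push_cast
        ring
      have hx1 : pderiv 1 (X 0 ^ (N + 4) : MvPolynomial (Fin 2) ℂ) = 0 := by
        rw [pderiv_pow, pderiv_X_of_ne (by decide), mul_zero]
      rw [quarticOp_eq, hx1, map_zero, map_zero, add_zero, ← one_mul (X 0 ^ (N + 4)), ← C_1,
        hx0 _ (N + 3), hx0 _ (N + 2), hx0 _ (N + 1), hx0]
      push_cast
      congr 2
      ring
    have hsub : ∀ F G, _root_.quarticOp (F - G) = _root_.quarticOp F - _root_.quarticOp G := by
      intro F G
      simp only [quarticOp_eq, map_sub, map_add]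
      ring
    rw [hlin, hsub, hx] at hq
    have hCp : (C ((N + 1) * (N + 2) * (N + 3) * (N + 4) : ℂ) : MvPolynomial (Fin 2) ℂ) ≠ 0 := by
      rwa [Ne, C_eq_zero]
    apply mul_left_cancel₀ hCp
    rw [hq]
    have h1 : (C ((N + 1) * (N + 2) * (N + 3) * (N + 4) : ℂ) : MvPolynomial (Fin 2) ℂ) *
        C (1 / ((N + 1) * (N + 2) * (N + 3) * (N + 4) : ℂ)) = 1 := by
      rw [← C_mul, mul_one_div_cancel hp0, C_1]
    linear_combination (-(C (1 / ((q : ℂ) - 1)) * _root_.quarticOp W)) * h1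

/-! ### Zeros of the quadratic factor and the theorem -/

theorem norm_of_isRoot {z : ℂ}
    (h : (3 * Polynomial.X ^ 2 - 3 * Polynomial.X + 1 : Polynomial ℂ).IsRoot z) :
    ‖z‖ = 1 / Real.sqrt 3 := by
  have hz : 3 * z ^ 2 - 3 * z + 1 = 0 := by
    simpa [Polynomial.IsRoot] using h
  have hre := congrArg Complex.re hz
  have him := congrArg Complex.im hz
  simp [pow_two] at hre him
  have hn : Complex.normSq z = 1 / 3 := by
    rw [Complex.normSq_apply]
    -- The imaginary part of the equation. A real zero is excluded by the negative discriminant, so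
    -- `re z = 1/2` and `(im z)^2 = 1/12`.
    have him' : z.im * (2 * z.re - 1) = 0 := by linarith
    rcases mul_eq_zero.1 him' with h0 | h0
    · rw [h0] at hre
      nlinarith [sq_nonneg (2 * z.re - 1)]
    · have : z.re = 1 / 2 := by linarith
      rw [this] at hre ⊢
      linarith
  rw [Complex.norm_def, hn, Real.sqrt_div zero_le_one, Real.sqrt_one]

theorem theorem1p2 (k n : ℕ) (hk : 1 ≤ k) (hn : n = 12 * k + 6)
    (W Wstar : MvPolynomial (Fin 2) ℂ) (hW : IsExtremalTypeIII n W)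
    (hWstar : Wstar = C (1 / (ascPochhammer ℂ 4).eval ((n : ℂ) - 3)) *
      pderiv 0 ((pderiv 0)^[3] W + (pderiv 1)^[3] W)) :
    (IsExtremalTypeIII (n - 4) Wstar ∧
      ∀ V : MvPolynomial (Fin 2) ℂ, IsExtremalTypeIII (n - 4) V → V = Wstar) ∧
    zetaPolynomial 3 Wstar =
      (3 * Polynomial.X ^ 2 - 3 * Polynomial.X + 1) * zetaPolynomial 3 W ∧
    (RiemannHyp 3 W ↔ RiemannHyp 3 Wstar) := by
  obtain ⟨d, ⟨hform, hmem, hσ⟩, hd⟩ := hW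
  have hfloor : ⌊((n : ℝ) - 6) / 12⌋ = k := by
    rw [Int.floor_eq_iff, hn]
    push_cast
    constructor <;> linarith
  have hfloor' : ⌊(((n - 4 : ℕ) : ℝ) - 6) / 12⌋ = k - 1 := by
    rw [Int.floor_eq_iff, hn, show 12 * k + 6 - 4 = 12 * k + 2 by omega]
    push_cast
    constructor <;> linarith
  rw [hfloor] at hd
  obtain rfl : d = 3 * k + 3 := by omega
  change Wstar = C (1 / (ascPochhammer ℂ 4).eval ((n : ℂ) - 3)) * quarticOp W at hWstar
  have hform' := hform.quarticOp (by omega) (by omega)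
  have hmem' := Subalgebra.mul_mem _
    (Subalgebra.algebraMap_mem (Algebra.adjoin ℂ ({W4, psi6} : Set (MvPolynomial (Fin 2) ℂ)))
      (1 / (ascPochhammer ℂ 4).eval ((n : ℂ) - 3))) (quarticOp_mem_adjoin hmem)
  rw [algebraMap_eq, ← hWstar] at hmem'
  rw [← hWstar, show 3 * k + 3 - 3 = 3 * k by omega] at hform'
  have hn4 : n - 4 = 12 * k + 2 := by omega
  have hP : IsZetaPolynomialAt 3 n (3 * k + 3) W (zetaPolynomial 3 W) :=
    (zetaPolynomial_eq_iff 3 hform _).1 rfl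
  -- Here `deg P ≤ 6k+2` while `n-d = 9k+3`; the required margin `6k+5 ≤ 9k+3` holds because `k ≥
  -- 1`.
  have hdeg := natDegree_zetaPolynomial_le (q := 3) (ε := -1) (by norm_num) hform
    (by rw [hσ]; simp) hP (by omega) (by omega)
  have hP' := hP.quarticOp (by omega) (by omega) (by omega) (by omega)
  rw [← hWstar, show 3 * k + 3 - 3 = 3 * k by omega] at hP'
  have hzeta := (zetaPolynomial_eq_iff 3 hform' _).2 hP'
  obtain ⟨-, -, hh, hlead, hlow, -⟩ := hasForm_iff.1 hform'
  refine ⟨⟨⟨3 * k, ⟨hform', hmem', linearAction_eq_neg hmem' hh (by omega)⟩, ?_⟩, ?_⟩, hzeta, ?_⟩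
  · rw [hfloor']; push_cast; ring
  · rintro V ⟨d', ⟨hVform, hVmem, -⟩, hd'⟩
    rw [hfloor'] at hd'
    obtain rfl : d' = 3 * k := by omega
    obtain ⟨-, -, hVh, hVlead, hVlow, -⟩ := hasForm_iff.1 hVform
    rw [← sub_eq_zero]
    rw [hn4] at hh hlead hlow hVh hVlead hVlow
    -- Both polynomials have coefficient `1` at `y^0` and `0` at `y^b` for `0 < b < 3k`.
    refine eq_zero_of_coeff_eq_zero (k := k) (Subalgebra.sub_mem _ hVmem hmem') (hVh.sub hh) ?_
    intro b hb
    rw [coeff_sub]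
    rcases Nat.eq_zero_or_pos b with rfl | hb0
    · rw [Nat.sub_zero, hVlead, hlead, sub_self]
    · rw [hVlow b hb0 hb, hlow b hb0 hb, sub_self]
  · simp only [RiemannHyp, hzeta, Polynomial.IsRoot.def, Polynomial.eval_mul, mul_eq_zero]
    refine ⟨fun h z hz => hz.elim (fun h' => norm_of_isRoot h') (h z), fun h z hz => h z (Or.inr hz)⟩
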